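/- \textbf{Definitions.} Let $A$ be a finite set with $|A|\geqslant 2$. An \emph{$m$-variable word over $A$ of length $n$} ($m,n\geqslant 1$) is a sequence $v$ of length $n$ with values in $A\cup\{x_1,\dots,x_m\}$, where $x_1,\dots,x_m\notin A$ are distinct variables, such that every $x_i$ appears in $v$ and, for $i<j$, all appearances of $x_i$ precede all appearances of $x_j$; $v(\alpha_1,\dots,\alpha_m)\in A^n$ is obtained by replacing every $x_i$ with $\alpha_i\in A$. An \emph{$m$-dimensional combinatorial subspace of $A^n$} is a set $V=\{v(\alpha_1,\dots,\alpha_m):\alpha_1,\dots,\alpha_m\in A\}$ with $v$ an $m$-variable word over $A$ of length $n$ (then $m$ and $v$ are determined by $V$); for $m=1$ it is called a \emph{combinatorial line}. The \emph{canonical isomorphism} $\mathrm{I}_V\colon A^m\to V$ is $\mathrm{I}_V(\alpha_1,\dots,\alpha_m)=v(\alpha_1,\dots,\alpha_m)$. The combinatorial lines (subspaces) of $V$ are those contained in $V$. For positive integers $k,m,r$ with $k\geqslant 2$ let $\mathrm{GRL}(k,m,r)$ be the least positive integer $N$ such that for every set $A$ with $|A|=k$, every $n$, every combinatorial subspace $V$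 of $A^n$ of dimension at least $N$, and every $r$-coloring of the set of all combinatorial lines of $V$, there is an $m$-dimensional combinatorial subspace $W$ of $V$ all of whose combinatorial lines have the same color. (Such an $N$ exists by the Graham--Rothschild theorem.) For distinct $\alpha,\beta\in A$, two elements $s,t\in A^m$ are \emph{$(\alpha,\beta)$-equivalent} if for every coordinate $i$ and every $\gamma\in A\setminus\{\alpha,\beta\}$ we have $s_i=\gamma$ if and only if $t_i=\gamma$. A set $\mathcal{E}\subseteq A^m$ is \emph{$(\alpha,\beta)$-insensitive} if for all $(\alpha,\beta)$-equivalent $s,t\in A^m$ we have $s\in\mathcal{E}$ if and only if $t\in\mathcal{E}$. A subset $\mathcal{E}$ of an $m$-dimensional combinatorial subspace $V$ is \emph{$(\alpha,\beta)$-insensitive in $V$} if $\mathrm{I}_V^{-1}(\mathcal{E})$ is $(\alpha,\beta)$-insensitive. \textbf{Statement.} Let $m\geqslant k\geqslant 2$ be integers and let $0<\delta\leqslant 1$. Set \[ N=\mathrm{GRL}\Big(k+1,\,m+1,\,\big\lceil 2(k+1)4^k\delta^{-(k+1)}\big\rceil^{\,2^{k+1}-1}\Big) \] and let $n$ be a positive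 integer such that \[ n\geqslant \frac{2(k+1)4^k}{\delta^{k+1}}\,(k+1)^N N. \] Let $A$ be a set with $|A|=k+1$ and let $D\subseteq A^n$ with $|D|\geqslant\delta|A^n|$. Then either \begin{enumerate} \item[(i)] $D$ contains a combinatorial line of $A^n$, or \item[(ii)] there exist $\beta\in A$, an $m$-dimensional combinatorial subspace $V$ of $A^n$ and a subset $\mathcal{S}$ of $V$ such that \begin{enumerate} \item[(a)] $\mathcal{S}=\bigcap_{\alpha\in A\setminus\{\beta\}}\mathcal{E}^\alpha$, where for every $\alpha\in A\setminus\{\beta\}$ the set $\mathcal{E}^\alpha\subseteq V$ is $(\alpha,\beta)$-insensitive in $V$, and \item[(b)] \[ \frac{|\mathcal{S}|}{|V|}\geqslant\frac{\delta^{2k+1}}{(k+1)^2\,4^{k+2}}\quad\text{and}\quad \frac{|D\cap\mathcal{S}|}{|\mathcal{S}|}\geqslant\delta+\frac{\delta^{k+1}}{(k+1)\,4^{k+1}}. \] \end{enumerate} \end{enumerate} -/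

import Mathlib

namespace DensityHJ

/-- An `m`-variable word over `A` of length `n`: a sequence of length `n` with values in
`A ∪ {x_1, …, x_m}` in which every variable occurs (this is Mathlib's `Combinatorics.Subspace`),
and in which, for `i < j`, all occurrences of `x_i` precede all occurrences of `x_j`. -/
structure VarWord (A : Type*) (m n : ℕ) extends Combinatorics.Subspace (Fin m) A (Fin n) where
  ordered : ∀ i j : Fin m, i < j → ∀ p q : Fin n,
    idxFun p = Sum.inr i → idxFun q = Sum.inr j → p < q

variable {A : Type*} {m n : ℕ}

/-- The word `v(a_1, …, a_m)`. As a map into its range, this is the canonical isomorphism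
of `A ^ m` with the combinatorial space generated by `v`. -/
def VarWord.subst (v : VarWord A m n) (a : Fin m → A) : Fin n → A :=
  v.toSubspace a

/-- The combinatorial space `{v(a_1, …, a_m) : a_1, …, a_m ∈ A}` generated by `v`. -/
def VarWord.space (v : VarWord A m n) : Set (Fin n → A) :=
  Set.range v.subst

/-- `V` is an `m`-dimensional combinatorial space (contained in `A ^ n`). -/
def IsCombSpace (m : ℕ) (V : Set (Fin n → A)) : Prop :=
  ∃ v : VarWord A m n, V = v.space

/-- `L` is a combinatorial line of `A ^ n`. -/
def IsCombLine (L : Set (Fin n → A)) : Prop :=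
  ∃ l : Combinatorics.Line A (Fin n), L = Set.range (fun a => l a)

/-- `N` has the Graham–Rothschild property for lines: for every set `A` with `k` elements, every
combinatorial space `V` over `A` of dimension at least `N` and every `r`-coloring of the
combinatorial lines of `V`, some `m`-dimensional combinatorial subspace `W` of `V` has all its
combinatorial lines of the same color. -/
def HasGRLProperty (k m r N : ℕ) : Prop :=
  ∀ (A : Type) [Fintype A], Fintype.card A = k →
    ∀ (n d : ℕ) (V : Set (Fin n → A)), IsCombSpace d V → N ≤ d →
      ∀ c : {L : Set (Fin n → A) // IsCombLine L ∧ L ⊆ V} → Fin r,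
        ∃ W : Set (Fin n → A), IsCombSpace m W ∧ W ⊆ V ∧
          ∃ i : Fin r, ∀ L : {L : Set (Fin n → A) // IsCombLine L ∧ L ⊆ V}, L.1 ⊆ W → c L = i

/-- The Graham–Rothschild number for lines: the least positive integer with `HasGRLProperty`. -/
noncomputable def GRL (k m r : ℕ) : ℕ :=
  sInf {N : ℕ | 0 < N ∧ HasGRLProperty k m r N}

/-- `s` and `t` possibly differ only in the coordinates taking values in `{α, β}`. -/
def Equivalent (α β : A) (s t : Fin n → A) : Prop :=
  ∀ i : Fin n, ∀ γ : A, γ ≠ α → γ ≠ β → (s i = γ ↔ t i = γ)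

/-- A subset of `A ^ n` is `(α, β)`-insensitive if it is a union of `(α, β)`-equivalence classes. -/
def Insensitive (α β : A) (E : Set (Fin n → A)) : Prop :=
  ∀ s t : Fin n → A, Equivalent α β s t → (t ∈ E ↔ s ∈ E)

/-- `E` is a subset of the combinatorial space `V` generated by `v` and is `(α, β)`-insensitive
in `V`: its preimage under the canonical isomorphism is `(α, β)`-insensitive. -/
def VarWord.InsensitiveIn (v : VarWord A m n) (α β : A) (E : Set (Fin n → A)) : Prop :=
  E ⊆ v.space ∧ Insensitive α β (v.subst ⁻¹' E)

end DensityHJ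

/-!
Write `ε = δ ^ (k + 1) / (2 (k + 1) 4 ^ k)`. The argument combines the Graham–Rothschild theorem for
lines with a density increment.

*Existence of the Graham–Rothschild number* (`GRL_spec`). As `GRL` is an infimum of natural numbers,
it has the property that defines it only because some number does, which is proved here with
ultrafilters. Let `p` be a minimal idempotent of the compact right-topological semigroup of
ultrafilters on the words over `A`. Below it there is an idempotent `q` in the closed ideal of
ultrafilters concentrated on variable words, and by minimality of `p` every substitution of a letter
for the variable maps `q` to `p`. A color class of `q`-measure one then contains all variable words
obtained from a suitable `m`-variable word, whose variables are chosen one at a time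
(`exists_varlist`). All of them have the same length `d`, so no compactness argument is needed: if
every dimension had a bad coloring, these would combine to one coloring of all variable words, and
the `m`-variable word found for it would show that the coloring in dimension `d` is not bad.

*Regularization* (`exists_block`). Either the density of `D` increases after some block of `N`
coordinates is fixed, or all sections of `D` at that block have density at least `δ - ε`. The first
case occurs fewer than `n / N` times, so a block with good sections exists.

*Uniformization* (`LineRamsey.exists_almost_constant`). Color each line `ℓ` of `A ^ N` by the
densities, up to `ε`, of `⋂ α ∈ J, D_{ℓ(α)}` for all nonempty `J ⊆ A`, where `D_t` is the section of
`D` at `t`. On the lines of an `(m + 1)`-dimensional space these densities are almost constant. They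
are at least `δ - ε` for singletons, and `0` for `J = A` when `D` contains no line. So for some `J`
and `β ∉ J` the density drops by a factor `δ / 4` from `J` to `J ∪ {β}` (`exists_drop`).

*Increment* (`exists_increment_cell`). The words `s` over `A` of length `m`, followed by `β`, form an
`m`-dimensional space. The line through such a point obtained by replacing `β` with the variable
(`lineThrough`) shows that `D` is sparse on the intersection of the sets `E α`, `α ∈ J`, of all `s`
whose line has its point at `α` in `D`. The set `E α` is `(α, β)`-insensitive. Hence `D` is denser
than average on the complement of the intersection, which splits into at most `k` intersections of
insensitive sets, and on one of these, in one fibre, the increment is found.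
-/

namespace DensityHJ

/-! ### Idempotents in compact right-topological semigroups -/

section CompactSemigroup

variable {M : Type*} [Semigroup M] [TopologicalSpace M] [CompactSpace M] [T2Space M]

/-- Every compact right-topological semigroup has an idempotent that is minimal for the order
`q ≤ p ↔ q * p = q ∧ p * q = q`. Any idempotent of a minimal closed left ideal is one. -/
theorem exists_minimal_idempotent [Nonempty M] (hM : ∀ r : M, Continuous (· * r)) :
    ∃ p : M, p * p = p ∧ ∀ q : M, q * q = q → q * p = q → p * q = q → q = p := by
  let S : Set (Set M) := {I | IsClosed I ∧ I.Nonempty ∧ ∀ x : M, ∀ y ∈ I, x * y ∈ I}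
  obtain ⟨I, hI⟩ : ∃ I, Minimal (· ∈ S) I := by
    refine zorn_superset _ fun c hcs hc => ?_
    refine ⟨⋂₀ c, ⟨isClosed_sInter fun t ht => (hcs ht).1, ?_, fun x y hy => ?_⟩,
      fun s hs => Set.sInter_subset_of_mem hs⟩
    · obtain rfl | hne := c.eq_empty_or_nonempty
      · rw [Set.sInter_empty]
        exact Set.univ_nonempty
      · have := hne.coe_sort
        rw [Set.sInter_eq_iInter]
        exact IsCompact.nonempty_iInter_of_directed_nonempty_isCompact_isClosed _
          (DirectedOn.directed_val (IsChain.directedOn hc.symm)) (fun i => (hcs i.2).2.1)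
          (fun i => (hcs i.2).1.isCompact) (fun i => (hcs i.2).1)
    · rw [Set.mem_sInter]
      exact fun t ht => (hcs ht).2.2 x y (Set.mem_sInter.mp hy t ht)
  obtain ⟨hcl, hne, hmul⟩ := hI.prop
  obtain ⟨p, hpI, hp⟩ := exists_idempotent_in_compact_subsemigroup hM I hne hcl.isCompact
    (fun x _ y hy => hmul x y hy)
  refine ⟨p, hp, fun q hq hqp hpq => ?_⟩
  have hqI : q ∈ I := hqp ▸ hmul q p hpI
  -- By minimality `I = I * q`, so `p = y * q` for some `y`, whence `p * q = p`.
  have himg : (· * q) '' I = I := by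
    apply hI.eq_of_subset
    · refine ⟨(hM q).isClosedMap _ hcl, ⟨_, q, hqI, rfl⟩, ?_⟩
      rintro x _ ⟨y, hy, rfl⟩
      exact ⟨x * y, hmul x y hy, mul_assoc _ _ _⟩
    · rintro _ ⟨y, hy, rfl⟩
      exact hmul y q hqI
  obtain ⟨y, -, hy⟩ : p ∈ (· * q) '' I := himg.symm ▸ hpI
  have hyq : y * q = p := hy
  calc q = p * q := hpq.symm
    _ = y * q * q := by rw [hyq]
    _ = p := by rw [mul_assoc, hq, hyq]

/-- Below every idempotent there is an idempotent in any given closed two-sided ideal. -/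
theorem exists_idempotent_le_in_ideal (hM : ∀ r : M, Continuous (· * r)) {p : M} (hp : p * p = p)
    {J : Set M} (hJ : IsClosed J) (hne : J.Nonempty) (hl : ∀ x, ∀ y ∈ J, x * y ∈ J)
    (hr : ∀ x ∈ J, ∀ y, x * y ∈ J) :
    ∃ q ∈ J, q * q = q ∧ q * p = q ∧ p * q = q := by
  obtain ⟨_, ⟨y, hy, rfl⟩, he⟩ := exists_idempotent_in_compact_subsemigroup hM ((· * p) '' J)
    (hne.image _) (hJ.isCompact.image (hM p)) (by
      rintro _ ⟨x, hx, rfl⟩ _ ⟨y, hy, rfl⟩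
      exact ⟨x * p * y, hl _ _ hy, mul_assoc _ _ _⟩)
  simp only at he
  have hep : y * p * p = y * p := by rw [mul_assoc, hp]
  refine ⟨p * (y * p), hl _ _ (hr _ hy _), ?_, ?_, ?_⟩
  · calc p * (y * p) * (p * (y * p)) = p * (y * p * p * (y * p)) := by simp only [mul_assoc]
      _ = p * (y * p) := by rw [hep, he]
  · rw [mul_assoc, hep]
  · rw [← mul_assoc, hp]

end CompactSemigroup

/-! ### Ultrafilters on words and on variable words -/

section Words

attribute [local instance] Ultrafilter.mul Ultrafilter.semigroup

theorem ultrafilter_map_mul {M N : Type*} [Mul M] [Mul N] (f : M →ₙ* N) (U V : Ultrafilter M) :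
    (U * V).map f = U.map f * V.map f := by
  apply Ultrafilter.coe_injective
  refine Filter.ext' fun P => ?_
  change (∀ᶠ x in ↑(U * V), P (f x)) ↔ ∀ᶠ x in (U.map f : Filter N), ∀ᶠ y in (V.map f : Filter N),
    P (x * y)
  rw [Ultrafilter.eventually_mul]
  simp only [Ultrafilter.coe_map, Filter.eventually_map, map_mul]

variable {A : Type*}

/-- The substitution of `s` for the variable `none` in a word over `Option A`. Here `s` is a letter
or the variable itself. -/
def substWord (s : Option A) (w : List (Option A)) : List (Option A) :=
  w.map fun o => o.elim s some

/-- There are an ultrafilter `p` concentrated on the words over `A` and an ultrafilter `q`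
concentrated on the variable words such that `p * p = p`, `p * q = q * p = q * q = q`, and every
substitution of a letter for the variable maps `q` to `p`. These identities are written out in terms
of eventual membership. -/
theorem exists_word_ultrafilters [Nonempty A] :
    ∃ p q : Ultrafilter (List (Option A)),
      (∀ᶠ w : List (Option A) in p, none ∉ w) ∧ (∀ᶠ w : List (Option A) in q, none ∈ w) ∧
      (∀ P : List (Option A) → Prop, (∀ᶠ w in p, P w) → ∀ᶠ u in p, ∀ᶠ w in p, P (u ++ w)) ∧
      (∀ P : List (Option A) → Prop, (∀ᶠ w in q, P w) → ∀ᶠ u in p, ∀ᶠ w in q, P (u ++ w)) ∧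
      (∀ P : List (Option A) → Prop, (∀ᶠ w in q, P w) → ∀ᶠ u in q, ∀ᶠ w in p, P (u ++ w)) ∧
      (∀ P : List (Option A) → Prop, (∀ᶠ w in q, P w) → ∀ᶠ u in q, ∀ᶠ w in q, P (u ++ w)) ∧
      (∀ P : List (Option A) → Prop, ∀ a : A, (∀ᶠ w in p, P w) →
        ∀ᶠ w in q, P (substWord (some a) w)) := by
  have : Nonempty (Ultrafilter (FreeMonoid A)) := ⟨pure 1⟩
  obtain ⟨p₀, hp₀, hmin⟩ := exists_minimal_idempotent (M := Ultrafilter (FreeMonoid A))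
    Ultrafilter.continuous_mul_left
  let ι : FreeMonoid A →* FreeMonoid (Option A) := FreeMonoid.map some
  let T : A → FreeMonoid (Option A) →* FreeMonoid A := fun a =>
    FreeMonoid.map fun o => o.getD a
  have hTι : ∀ a w, T a (ι w) = w := fun a w => by
    induction w using FreeMonoid.inductionOn' with
    | one => simp
    | of_mul x w ih => simp only [map_mul, ih]; simp [T, ι]
  set p : Ultrafilter (FreeMonoid (Option A)) := p₀.map ι with hpdef
  have hpp : p * p = p :=
    (ultrafilter_map_mul (ι : FreeMonoid A →ₙ* FreeMonoid (Option A)) p₀ p₀).symm.trans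
      (by rw [hp₀]; rfl)
  let V : Set (FreeMonoid (Option A)) := {w | none ∈ FreeMonoid.toList w}
  obtain ⟨q, hqV, hqq, hqp, hpq⟩ := exists_idempotent_le_in_ideal
    (M := Ultrafilter (FreeMonoid (Option A))) Ultrafilter.continuous_mul_left hpp
    (J := {U | V ∈ U}) (ultrafilter_isClosed_basic V)
    ⟨pure (FreeMonoid.of none), by
      change FreeMonoid.of none ∈ V
      simp [V, FreeMonoid.toList_of]⟩
    (fun x y hy => by
      change ∀ᶠ u in x, ∀ᶠ w in y, u * w ∈ V
      refine Filter.Eventually.of_forall fun u => ?_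
      filter_upwards [hy] with w hw
      simp only [V, Set.mem_ofPred_eq, FreeMonoid.toList_mul, List.mem_append] at hw ⊢
      exact Or.inr hw)
    (fun x hx y => by
      change ∀ᶠ u in x, ∀ᶠ w in y, u * w ∈ V
      filter_upwards [hx] with u hu
      refine Filter.Eventually.of_forall fun w => ?_
      simp only [V, Set.mem_ofPred_eq, FreeMonoid.toList_mul, List.mem_append] at hu ⊢
      exact Or.inl hu)
  have hTp : ∀ a, p.map (T a) = p₀ := fun a => by
    rw [hpdef, Ultrafilter.map_map]
    have : T a ∘ ι = id := funext (hTι a)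
    rw [this, Ultrafilter.map_id]
  have hTq : ∀ a, q.map (T a) = p₀ := fun a => by
    have hmul := ultrafilter_map_mul (T a : FreeMonoid (Option A) →ₙ* FreeMonoid A)
    refine hmin _ ?_ ?_ ?_
    · exact (hmul q q).symm.trans (by rw [hqq]; rfl)
    · rw [← hTp a]
      exact (hmul q p).symm.trans (by rw [hqp]; rfl)
    · rw [← hTp a]
      exact (hmul p q).symm.trans (by rw [hpq]; rfl)
  have key : ∀ U V W : Ultrafilter (FreeMonoid (Option A)), U * V = W →
      ∀ P : List (Option A) → Prop, (∀ᶠ w in W, P (FreeMonoid.toList w)) →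
        ∀ᶠ u in U, ∀ᶠ w in V, P (FreeMonoid.toList u ++ FreeMonoid.toList w) := by
    rintro U V _ rfl P hP
    exact hP
  refine ⟨p, q, ?_, hqV, key p p p hpp, key p q q hpq, key q p q hqp, key q q q hqq, ?_⟩
  · change ∀ᶠ w in p₀, none ∉ FreeMonoid.toList (ι w)
    refine Filter.Eventually.of_forall fun w => ?_
    simp [ι, FreeMonoid.toList_map]
  · intro P a hP
    change ∀ᶠ w in p₀, P (FreeMonoid.toList (ι w)) at hP
    rw [← hTq a] at hP
    change ∀ᶠ w in q, P (FreeMonoid.toList (ι (T a w))) at hP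
    refine hP.mono fun w hw => ?_
    have : FreeMonoid.toList (ι (T a w)) = substWord (some a) (FreeMonoid.toList w) := by
      simp only [ι, T, FreeMonoid.toList_map, List.map_map, substWord]
      refine List.map_congr_left fun o _ => ?_
      cases o <;> rfl
    rwa [this] at hw

/-- Every set `P` of words that belongs to both ultrafilters contains, for some `m`-variable word
`u` over `A`, all the words obtained by substituting letters or the variable `none` for the
variables of `u`. The part of `u` that holds the first variable is chosen so that the set of
continuations admissible for all its substitutions again belongs to both ultrafilters. -/
theorem exists_varlist [Finite A] {p q : Ultrafilter (List (Option A))}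
    (hp : ∀ᶠ w : List (Option A) in p, none ∉ w) (hq : ∀ᶠ w : List (Option A) in q, none ∈ w)
    (hpp : ∀ P : List (Option A) → Prop,
      (∀ᶠ w in p, P w) → ∀ᶠ u in p, ∀ᶠ w in p, P (u ++ w))
    (hpq : ∀ P : List (Option A) → Prop,
      (∀ᶠ w in q, P w) → ∀ᶠ u in p, ∀ᶠ w in q, P (u ++ w))
    (hqp : ∀ P : List (Option A) → Prop,
      (∀ᶠ w in q, P w) → ∀ᶠ u in q, ∀ᶠ w in p, P (u ++ w))
    (hqq : ∀ P : List (Option A) → Prop,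
      (∀ᶠ w in q, P w) → ∀ᶠ u in q, ∀ᶠ w in q, P (u ++ w))
    (hT : ∀ P : List (Option A) → Prop, ∀ a : A, (∀ᶠ w in p, P w) →
        ∀ᶠ w in q, P (substWord (some a) w)) (m : ℕ) :
    ∀ P : List (Option A) → Prop, (∀ᶠ w in p, P w) → (∀ᶠ w in q, P w) →
      ∃ u : List (A ⊕ Fin m), (∀ i, Sum.inr i ∈ u) ∧
        u.Pairwise (fun x y => ∀ i j, x = Sum.inr i → y = Sum.inr j → i ≤ j) ∧
        ∀ s : Fin m → Option A, P (u.map (Sum.elim some s)) := by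
  induction m with
  | zero =>
    intro P hPp _
    obtain ⟨w, hw, hPw⟩ := (hp.and hPp).exists
    have hsome : ∀ o ∈ w, ∃ a, o = some a := fun o ho => by
      cases o with
      | none => exact absurd ho hw
      | some a => exact ⟨a, rfl⟩
    obtain ⟨w', rfl⟩ : ∃ w' : List A, w = w'.map some := by
      clear hw hPw
      induction w with
      | nil => exact ⟨[], rfl⟩
      | cons o w ih =>
        obtain ⟨w', rfl⟩ := ih fun o ho => hsome o (List.mem_cons_of_mem _ ho)
        obtain ⟨a, rfl⟩ := hsome o List.mem_cons_self
        exact ⟨a :: w', rfl⟩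
    refine ⟨w'.map Sum.inl, fun i => i.elim0, ?_, fun s => ?_⟩
    · exact List.pairwise_of_forall fun x y i => i.elim0
    · rw [List.map_map]
      exact hPw
  | succ m ih =>
    intro P hPp hPq
    have hDp : ∀ᶠ u in p, (∀ᶠ w in p, P (u ++ w)) ∧ ∀ᶠ w in q, P (u ++ w) :=
      (hpp P hPp).and (hpq P hPq)
    have hDq : ∀ᶠ u in q, (∀ᶠ w in p, P (u ++ w)) ∧ ∀ᶠ w in q, P (u ++ w) :=
      (hqp P hPq).and (hqq P hPq)
    have hall : ∀ᶠ v in q, ∀ s : Option A,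
        (∀ᶠ w in p, P (substWord s v ++ w)) ∧ ∀ᶠ w in q, P (substWord s v ++ w) := by
      rw [Filter.eventually_all]
      intro s
      cases s with
      | some a => exact hT _ a hDp
      | none =>
        refine hDq.mono fun v hv => ?_
        have : substWord none v = v := by
          refine (List.map_congr_left fun o _ => ?_).trans (List.map_id v)
          cases o <;> rfl
        rwa [this]
    obtain ⟨v, hv, hvs⟩ := (hq.and hall).exists
    obtain ⟨u, hu, hsort, huP⟩ := ih (fun w => ∀ s : Option A, P (substWord s v ++ w))
      (Filter.eventually_all.2 fun s => (hvs s).1) (Filter.eventually_all.2 fun s => (hvs s).2)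
    refine ⟨v.map (fun o => o.elim (Sum.inr 0) Sum.inl) ++ u.map (Sum.map id Fin.succ), ?_, ?_, ?_⟩
    · intro i
      rw [List.mem_append]
      refine Fin.cases (Or.inl ?_) (fun i => Or.inr ?_) i
      · exact List.mem_map.2 ⟨none, hv, rfl⟩
      · exact List.mem_map.2 ⟨_, hu i, rfl⟩
    · rw [List.pairwise_append]
      refine ⟨?_, ?_, ?_⟩
      · rw [List.pairwise_map]
        refine List.pairwise_of_forall fun x y i j hx hy => ?_
        cases x with
        | none =>
          cases hx
          exact Fin.zero_le _
        | some a => cases hx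
      · rw [List.pairwise_map]
        refine hsort.imp fun {x y} hxy i j hx hy => ?_
        cases x with
        | inl a => cases hx
        | inr i' =>
          cases y with
          | inl a => cases hy
          | inr j' =>
            cases hx
            cases hy
            exact Fin.succ_le_succ_iff.2 (hxy i' j' rfl rfl)
      · intro x hx y hy i j hxi hyj
        obtain ⟨o, -, rfl⟩ := List.mem_map.1 hx
        cases o with
        | none =>
          cases hxi
          exact Fin.zero_le _
        | some a => cases hxi
    · intro s
      have := huP (fun i => s i.succ) (s 0)
      convert this using 1
      rw [List.map_append, List.map_map, List.map_map, substWord]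
      congr 1
      · refine List.map_congr_left fun o _ => ?_
        cases o <;> rfl
      · refine List.map_congr_left fun o _ => ?_
        cases o <;> rfl

end Words


/-! ### Composition of variable words -/

section Composition

open Combinatorics

variable {A B : Type*} {l m n : ℕ}

/-- The line `a ↦ v(ℓ(a))` of the combinatorial space generated by `v`. -/
def VarWord.compLine (v : VarWord A m n) (ℓ : Line A (Fin m)) : Line A (Fin n) where
  idxFun p := (v.idxFun p).elim some ℓ.idxFun
  proper := by
    obtain ⟨i, hi⟩ := ℓ.proper
    obtain ⟨p, hp⟩ := v.proper i
    exact ⟨p, by simp [hp, hi]⟩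

/-- The variable word `v(w_1, …, w_m)` obtained from `v` by substituting the word `w`. -/
def VarWord.comp (v : VarWord A m n) (w : VarWord A l m) : VarWord A l n where
  idxFun p := (v.idxFun p).elim Sum.inl w.idxFun
  proper i := by
    obtain ⟨q, hq⟩ := w.proper i
    obtain ⟨p, hp⟩ := v.proper q
    exact ⟨p, by simp [hp, hq]⟩
  ordered i j hij p q hp hq := by
    cases hp' : v.idxFun p with
    | inl a => simp [hp'] at hp
    | inr i' =>
      cases hq' : v.idxFun q with
      | inl a => simp [hq'] at hq
      | inr j' =>
        simp only [hp', hq', Sum.elim_inr] at hp hq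
        exact v.ordered i' j' (w.ordered i j hij i' j' hp hq) p q hp' hq'

/-- The image of a variable word under a map of alphabets. -/
def VarWord.mapAlphabet (f : A → B) (v : VarWord A m n) : VarWord B m n where
  idxFun p := (v.idxFun p).map f id
  proper i := by
    obtain ⟨p, hp⟩ := v.proper i
    exact ⟨p, by simp [hp]⟩
  ordered i j hij p q hp hq := by
    cases hp' : v.idxFun p with
    | inl a => simp [hp'] at hp
    | inr i' =>
      cases hq' : v.idxFun q with
      | inl a => simp [hq'] at hq
      | inr j' =>
        simp only [hp', hq', Sum.map_inr, id, Sum.inr.injEq] at hp hq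
        subst hp hq
        exact v.ordered _ _ hij p q hp' hq'

theorem VarWord.subst_apply (v : VarWord A m n) (s : Fin m → A) (p : Fin n) :
    v.subst s p = (v.idxFun p).elim id s := rfl

theorem VarWord.compLine_apply (v : VarWord A m n) (ℓ : Line A (Fin m)) (a : A) :
    v.compLine ℓ a = v.subst (ℓ a) := by
  funext p
  rw [VarWord.subst_apply, Line.coe_apply]
  cases h : v.idxFun p <;> simp [VarWord.compLine, h]

theorem VarWord.comp_compLine (v : VarWord A m n) (w : VarWord A l m) (ℓ : Line A (Fin l)) :
    (v.comp w).compLine ℓ = v.compLine (w.compLine ℓ) := by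
  ext1
  funext p
  cases h : v.idxFun p <;> simp [VarWord.compLine, VarWord.comp, h]

theorem VarWord.comp_subst (v : VarWord A m n) (w : VarWord A l m) (s : Fin l → A) :
    (v.comp w).subst s = v.subst (w.subst s) := by
  funext p
  simp only [VarWord.subst_apply]
  cases h : v.idxFun p <;> simp [VarWord.comp, h, VarWord.subst_apply]

theorem VarWord.mapAlphabet_compLine (f : A → B) (v : VarWord A m n) (ℓ : Line A (Fin m)) :
    (v.mapAlphabet f).compLine (ℓ.map f) = (v.compLine ℓ).map f := by
  ext1
  funext p
  cases h : v.idxFun p <;> simp [VarWord.compLine, VarWord.mapAlphabet, Line.map, h]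

theorem VarWord.subst_injective (v : VarWord A m n) : Function.Injective v.subst := by
  intro s t hst
  funext i
  obtain ⟨p, hp⟩ := v.proper i
  simpa [VarWord.subst_apply, hp] using congrFun hst p

/-- The word `x_1 ⋯ x_m` followed by `n - m` letters `a`. -/
def VarWord.initial (a : A) (h : m ≤ n) : VarWord A m n where
  idxFun p := if hp : p.1 < m then Sum.inr ⟨p, hp⟩ else Sum.inl a
  proper i := ⟨Fin.castLE h i, by simp⟩
  ordered i j hij p q hp hq := by
    split_ifs at hp hq
    simp only [Sum.inr.injEq] at hp hq
    subst hp hq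
    exact hij

/-- Over an alphabet with two letters a line is determined by its set of points. -/
theorem line_eq_of_range_eq [Nontrivial A] {ℓ ℓ' : Line A (Fin n)}
    (h : Set.range (fun a => ℓ a) = Set.range (fun a => ℓ' a)) : ℓ = ℓ' := by
  have key : ∀ ℓ ℓ' : Line A (Fin n), Set.range (fun a => ℓ a) = Set.range (fun a => ℓ' a) →
      ∀ i b, ℓ.idxFun i = some b → ℓ'.idxFun i = some b := by
    intro ℓ ℓ' h i b hb
    have hval : ∀ a, ℓ' a i = b := fun a => by
      obtain ⟨a', ha'⟩ : ℓ' a ∈ Set.range (fun a => ℓ a) := h ▸ ⟨a, rfl⟩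
      rw [← ha']
      simp [hb]
    cases hi : ℓ'.idxFun i with
    | none =>
      obtain ⟨c, hc⟩ := exists_ne b
      exact absurd (by simpa [hi] using hval c) hc
    | some c => simpa [hi] using hval b
  ext i b
  exact ⟨key ℓ ℓ' h i b, key ℓ' ℓ h.symm i b⟩

/-- A line contained in a combinatorial space is the image of a line under the canonical
isomorphism. -/
theorem VarWord.exists_compLine_eq [Nontrivial A] (v : VarWord A m n) (ℓ : Line A (Fin n))
    (h : Set.range (fun a => ℓ a) ⊆ v.space) :
    ∃ ℓ' : Line A (Fin m), Set.range (fun a => v.compLine ℓ' a) = Set.range (fun a => ℓ a) := by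
  choose p hp using v.proper
  have hs : ∀ a, v.subst (fun i => (ℓ.idxFun (p i)).getD a) = ℓ a := fun a => by
    obtain ⟨s, hs⟩ : ℓ a ∈ v.space := h ⟨a, rfl⟩
    rw [← hs]
    congr 1
    funext i
    have := congrFun hs (p i)
    simpa [VarWord.subst_apply, hp] using this.symm
  refine ⟨⟨fun i => ℓ.idxFun (p i), ?_⟩, ?_⟩
  · by_contra! hne
    obtain ⟨a, b, hab⟩ := exists_pair_ne A
    have hconst : ℓ a = ℓ b := by
      rw [← hs a, ← hs b]
      congr 1
      funext i
      obtain ⟨c, hc⟩ := Option.ne_none_iff_exists'.1 (hne i)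
      simp [hc]
    obtain ⟨i, hi⟩ := ℓ.proper
    exact hab (by simpa [hi] using congrFun hconst i)
  · congr 1
    funext a
    rw [VarWord.compLine_apply]
    exact hs a

end Composition

/-! ### The Graham–Rothschild theorem for lines -/

section GrahamRothschild

open Combinatorics

/-- Every `r`-coloring of the lines of `A ^ d` is constant on the lines of some `m`-dimensional
combinatorial space. Here lines are parametrized, so that no subset of `A ^ d` is mentioned. -/
def LineRamsey (A : Type*) (m d r : ℕ) : Prop :=
  ∀ c : Line A (Fin d) → Fin r, ∃ (w : VarWord A m d) (i : Fin r), ∀ ℓ, c (w.compLine ℓ) = i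

variable {A B : Type*} {m d r : ℕ}

/-- If every dimension had a bad coloring, these would combine to a single coloring of all
variable words, a word of length `d` receiving the color given to it in dimension `d`. -/
theorem exists_lineRamsey (A : Type*) [Finite A] [Nonempty A] (m r : ℕ) :
    ∃ d, LineRamsey A m d r := by
  classical
  by_contra hbad
  simp only [LineRamsey, not_exists, not_forall] at hbad
  choose c hc using hbad
  obtain ⟨p, q, hp, hq, hpp, hpq, hqp, hqq, hT⟩ := exists_word_ultrafilters (A := A)
  let f : List (Option A) → Option (Fin r) := fun w =>
    if h : none ∈ w then some (c w.length ⟨w.get, List.mem_iff_get.1 h⟩) else none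
  have hf : ∀ (d : ℕ) (ℓ : Line A (Fin d)) (w : List (Option A)) (hd : w.length = d),
      (∀ i, w.get i = ℓ.idxFun (Fin.cast hd i)) → f w = some (c d ℓ) := by
    rintro _ ℓ w rfl hw
    obtain ⟨i, hi⟩ := ℓ.proper
    have hmem : none ∈ w := List.mem_iff_get.2 ⟨i, (hw i).trans hi⟩
    simp only [f, hmem, dif_pos, Option.some.injEq]
    congr 1
    ext1
    exact funext hw
  obtain ⟨o, ho⟩ : ∃ o, ∀ᶠ w in q, f w = o := by
    obtain ⟨o, ho⟩ := Ultrafilter.eq_pure_of_finite (q.map f)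
    refine ⟨o, ?_⟩
    have : {o} ∈ q.map f := by rw [ho]; exact Set.mem_singleton o
    exact this
  obtain ⟨u, hu, hsort, huP⟩ := exists_varlist hp hq hpp hpq hqp hqq hT m
    (fun w => none ∈ w → f w = o) (hp.mono fun w hw h => absurd h hw) (ho.mono fun w hw _ => hw)
  let v : VarWord A m u.length :=
    { idxFun := u.get
      proper := fun i => List.mem_iff_get.1 (hu i)
      ordered := fun i j hij s t hs ht => by
        by_contra hlt
        rcases (not_lt.1 hlt).eq_or_lt with h | h
        · subst h
          rw [hs] at ht
          exact hij.ne (Sum.inr.inj ht)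
        · exact absurd (List.pairwise_iff_get.1 hsort t s h j i ht hs) (not_le.2 hij) }
  have hline : ∀ ℓ : Line A (Fin m), some (c _ (v.compLine ℓ)) = o := fun ℓ => by
    have h1 := hf _ (v.compLine ℓ) (u.map (Sum.elim some ℓ.idxFun)) (by simp) (fun i => by
      simp [v, VarWord.compLine])
    rw [← h1]
    refine huP ℓ.idxFun ?_
    obtain ⟨i, hi⟩ := ℓ.proper
    exact List.mem_map.2 ⟨_, hu i, hi⟩
  cases o with
  | none =>
    obtain ⟨w, hw, hw'⟩ := (ho.and hq).exists
    simp [f, hw'] at hw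
  | some i =>
    obtain ⟨ℓ, hℓ⟩ := hc u.length v i
    exact hℓ (Option.some.inj (hline ℓ))

theorem LineRamsey.mono [Nonempty A] {d' : ℕ} (h : LineRamsey A m d r) (hd : d ≤ d') :
    LineRamsey A m d' r := by
  intro c
  let v : VarWord A d d' := VarWord.initial (Classical.arbitrary A) hd
  obtain ⟨w, i, hw⟩ := h fun ℓ => c (v.compLine ℓ)
  exact ⟨v.comp w, i, fun ℓ => by rw [VarWord.comp_compLine]; exact hw ℓ⟩

theorem LineRamsey.of_equiv (e : A ≃ B) (h : LineRamsey B m d r) : LineRamsey A m d r := by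
  intro c
  obtain ⟨w, i, hw⟩ := h fun ℓ => c (ℓ.map e.symm)
  refine ⟨w.mapAlphabet e.symm, i, fun ℓ => ?_⟩
  have hℓ : (ℓ.map e).map e.symm = ℓ := by
    ext1
    funext p
    cases h : ℓ.idxFun p <;> simp [Line.map, h]
  rw [← hw (ℓ.map e), ← VarWord.mapAlphabet_compLine, hℓ]

theorem hasGRLProperty_of_lineRamsey {k N : ℕ} (hk : 2 ≤ k) (h : LineRamsey (Fin k) m N r) :
    HasGRLProperty k m r N := by
  intro A _ hA n d V hV hN c
  have : Nontrivial A := Fintype.one_lt_card_iff_nontrivial.1 (by omega)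
  obtain ⟨v, rfl⟩ := hV
  have hmem : ∀ ℓ : Line A (Fin d), IsCombLine (Set.range fun a => v.compLine ℓ a) ∧
      (Set.range fun a => v.compLine ℓ a) ⊆ v.space := fun ℓ => by
    refine ⟨⟨_, rfl⟩, ?_⟩
    rintro _ ⟨a, rfl⟩
    exact ⟨ℓ a, (v.compLine_apply ℓ a).symm⟩
  obtain ⟨w, i, hw⟩ := (h.of_equiv (Fintype.equivFinOfCardEq hA)).mono hN
    fun ℓ => c ⟨_, hmem ℓ⟩
  refine ⟨(v.comp w).space, ⟨_, rfl⟩, ?_, i, ?_⟩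
  · rintro _ ⟨s, rfl⟩
    exact ⟨w.subst s, (v.comp_subst w s).symm⟩
  · rintro ⟨_, ⟨ℓ, rfl⟩, hL⟩ hLW
    obtain ⟨ℓ', hℓ'⟩ := (v.comp w).exists_compLine_eq ℓ hLW
    rw [VarWord.comp_compLine] at hℓ'
    rw [← hw ℓ']
    exact congrArg c (Subtype.ext hℓ'.symm)

theorem HasGRLProperty.lineRamsey {k N : ℕ} (hk : 2 ≤ k) (h : HasGRLProperty k m r N) :
    LineRamsey (Fin k) m N r := by
  intro c
  have : Nontrivial (Fin k) := Fin.nontrivial_iff_two_le.2 hk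
  let v : VarWord (Fin k) N N := VarWord.initial ⟨0, by omega⟩ le_rfl
  obtain ⟨W, ⟨w, rfl⟩, -, i, hi⟩ := h (Fin k) (Fintype.card_fin k) N N v.space ⟨v, rfl⟩ le_rfl
    (fun L => c L.2.1.choose)
  refine ⟨w, i, fun ℓ => ?_⟩
  have hline : IsCombLine (Set.range fun a => w.compLine ℓ a) := ⟨_, rfl⟩
  have hv : ∀ s, v.subst s = s := fun s => by
    funext p
    simp [VarWord.subst_apply, v, VarWord.initial]
  rw [← hi ⟨_, hline, fun s _ => ⟨s, hv s⟩⟩ (by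
    rintro _ ⟨a, rfl⟩
    exact ⟨ℓ a, (w.compLine_apply ℓ a).symm⟩)]
  congr 1
  exact line_eq_of_range_eq hline.choose_spec

/-- The Graham–Rothschild theorem for lines: the number `GRL k m r` is positive and has the property
that defines it. -/
theorem GRL_spec {k : ℕ} (hk : 2 ≤ k) (m r : ℕ) :
    0 < GRL k m r ∧ HasGRLProperty k m r (GRL k m r) := by
  have : Nonempty (Fin k) := ⟨⟨0, by omega⟩⟩
  obtain ⟨d, hd⟩ := exists_lineRamsey (Fin k) m r
  exact Nat.sInf_mem (s := {N : ℕ | 0 < N ∧ HasGRLProperty k m r N})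
    ⟨d + 1, d.succ_pos, hasGRLProperty_of_lineRamsey hk (hd.mono d.le_succ)⟩

end GrahamRothschild


/-! ### Densities and blocks of coordinates -/

section Density

variable {X Y : Type*} [Fintype X] [Fintype Y]

/-- The density of a subset of a finite type, that is, its uniform probability. -/
noncomputable def dens (S : Set Y) : ℝ :=
  (S.ncard : ℝ) / Fintype.card Y

theorem sum_indicator_one (S : Set Y) : ∑ y, S.indicator (1 : Y → ℝ) y = S.ncard := by
  classical
  simp only [Set.indicator_apply, Pi.one_apply, Finset.sum_boole, Set.ncard_eq_toFinset_card',
    Set.toFinset_card, Fintype.card_subtype]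

theorem sum_indicator_eq_card_mul_dens [Nonempty Y] (S : Set Y) :
    ∑ y, S.indicator (1 : Y → ℝ) y = Fintype.card Y * dens S := by
  have : (Fintype.card Y : ℝ) ≠ 0 := Nat.cast_ne_zero.2 Fintype.card_ne_zero
  rw [sum_indicator_one, dens]
  field_simp

theorem dens_nonneg (S : Set Y) : 0 ≤ dens S := by
  unfold dens
  positivity

theorem dens_le_one (S : Set Y) : dens S ≤ 1 := by
  refine div_le_one_of_le₀ ?_ (Nat.cast_nonneg _)
  rw [← Nat.card_eq_fintype_card]
  exact_mod_cast Set.ncard_le_card S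

end Density

section Blocks

theorem extend_comm {A : Type*} {N n : ℕ} {e e' : Fin N → Fin n} (he : Function.Injective e)
    (he' : Function.Injective e') (hne : ∀ p q, e p ≠ e' q) (t t' : Fin N → A) (y : Fin n → A) :
    Function.extend e t (Function.extend e' t' y) =
      Function.extend e' t' (Function.extend e t y) := by
  funext i
  by_cases hi : ∃ p, e p = i
  · obtain ⟨p, rfl⟩ := hi
    rw [he.extend_apply, Function.extend_apply' _ _ _ fun ⟨q, hq⟩ => hne p q hq.symm,
      he.extend_apply]
  · rw [Function.extend_apply' _ _ _ hi]
    by_cases hi' : ∃ q, e' q = i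
    · obtain ⟨q, rfl⟩ := hi'
      rw [he'.extend_apply, he'.extend_apply]
    · rw [Function.extend_apply' _ _ _ hi', Function.extend_apply' _ _ _ hi',
        Function.extend_apply' _ _ _ hi]

variable {A : Type*} [Fintype A] [Nonempty A] {N n : ℕ}

/-- Resampling a block of coordinates preserves the uniform measure. -/
theorem sum_dens_extend (e : Fin N → Fin n) (he : Function.Injective e) (S : Set (Fin n → A)) :
    ∑ t : Fin N → A, dens {y | Function.extend e t y ∈ S} =
      Fintype.card (Fin N → A) * dens S := by
  classical
  have hY : (Fintype.card (Fin n → A) : ℝ) ≠ 0 := Nat.cast_ne_zero.2 Fintype.card_ne_zero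
  -- The pairs (block, word) are permuted by exchanging the block with its counterpart in the word.
  let σ : (Fin N → A) × (Fin n → A) → (Fin N → A) × (Fin n → A) := fun z =>
    (z.2 ∘ e, Function.extend e z.1 z.2)
  have hσ : Function.Involutive σ := by
    rintro ⟨t, y⟩
    refine Prod.ext (funext fun p => he.extend_apply _ _ _) (funext fun i => ?_)
    by_cases hi : ∃ p, e p = i
    · obtain ⟨p, rfl⟩ := hi
      exact he.extend_apply _ _ _
    · exact (Function.extend_apply' _ _ _ hi).trans (Function.extend_apply' _ _ _ hi)
  apply mul_left_cancel₀ hY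
  calc (Fintype.card (Fin n → A) : ℝ) * ∑ t : Fin N → A, dens {y | Function.extend e t y ∈ S}
      = ∑ z : (Fin N → A) × (Fin n → A), S.indicator (1 : (Fin n → A) → ℝ) (σ z).2 := by
        rw [Finset.mul_sum, Fintype.sum_prod_type]
        refine Finset.sum_congr rfl fun t _ => ?_
        rw [← sum_indicator_eq_card_mul_dens]
        rfl
    _ = ∑ z : (Fin N → A) × (Fin n → A), S.indicator (1 : (Fin n → A) → ℝ) z.2 :=
        Equiv.sum_comp hσ.toPerm fun z => S.indicator (1 : (Fin n → A) → ℝ) z.2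
    _ = Fintype.card (Fin n → A) * (Fintype.card (Fin N → A) * dens S) := by
        rw [Fintype.sum_prod_type]
        simp only [sum_indicator_eq_card_mul_dens, Finset.sum_const, Finset.card_univ,
          nsmul_eq_mul]
        ring

/-- The `l`-th of `M` consecutive blocks of `N` coordinates. -/
def blockEmb {M : ℕ} (h : M * N ≤ n) (l : Fin M) : Fin N ↪o Fin n :=
  OrderEmbedding.ofStrictMono
    (fun p => ⟨l * N + p, by
      have h1 : (l.1 + 1) * N ≤ M * N := Nat.mul_le_mul_right _ l.2
      have h2 := p.2
      rw [Nat.succ_mul] at h1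
      omega⟩)
    (fun p q hpq => by
      have : p.1 < q.1 := hpq
      simp only [Fin.mk_lt_mk]
      omega)

theorem blockEmb_ne {M : ℕ} (h : M * N ≤ n) {l l' : Fin M} (hl : l < l') (p q : Fin N) :
    blockEmb h l p ≠ blockEmb h l' q := by
  intro heq
  have h1 : l.1 * N + p.1 = l'.1 * N + q.1 := congrArg Fin.val heq
  have h2 : (l.1 + 1) * N ≤ l'.1 * N := Nat.mul_le_mul_right _ hl
  have h3 := p.2
  rw [Nat.succ_mul] at h2
  omega

/-- Density increment over blocks: if some filling of a block makes the density drop below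
`δ - ε`, another filling raises it by `ε / |A| ^ N`, and fixing that filling one passes to the next
block. As densities do not exceed `1`, after fixing some blocks (the map `φ`) a block is met
all of whose fillings leave density at least `δ - ε`. -/
theorem exists_block (D : Set (Fin n → A)) {M : ℕ} (hMN : M * N ≤ n) {δ ε : ℝ} (hε : 0 < ε)
    (hD : δ ≤ dens D) (hM : 1 < δ + M * (ε / Fintype.card (Fin N → A))) :
    ∃ (e : Fin N ↪o Fin n) (φ : (Fin n → A) → Fin n → A),
      ∀ t : Fin N → A, δ - ε ≤ dens {y | Function.extend e t (φ y) ∈ D} := by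
  classical
  by_contra! hbad
  set K : ℝ := (Fintype.card (Fin N → A) : ℝ) with hKdef
  have hK : 0 < K := Nat.cast_pos.2 Fintype.card_pos
  have key : ∀ j : ℕ, j ≤ M → ∃ φ : (Fin n → A) → Fin n → A,
      (∀ l : Fin M, j ≤ l → ∀ t y, φ (Function.extend (blockEmb hMN l) t y) =
        Function.extend (blockEmb hMN l) t (φ y)) ∧
      δ + j * (ε / K) ≤ dens {y | φ y ∈ D} := by
    intro j
    induction j with
    | zero => exact fun _ => ⟨id, fun _ _ _ _ => rfl, by simpa using hD⟩
    | succ j ih =>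
      intro hj
      obtain ⟨φ, hφ, hd⟩ := ih (by omega)
      let l : Fin M := ⟨j, hj⟩
      obtain ⟨t₀, ht₀⟩ := hbad (blockEmb hMN l) φ
      set d := dens {y | φ y ∈ D}
      set g : (Fin N → A) → ℝ := fun t => dens {y | Function.extend (blockEmb hMN l) t (φ y) ∈ D}
      have hsum : ∑ t, g t = K * d := by
        rw [hKdef, ← sum_dens_extend (blockEmb hMN l) (blockEmb hMN l).injective]
        refine Finset.sum_congr rfl fun t _ => ?_
        simp only [g, Set.mem_ofPred_eq, hφ l le_rfl]
      obtain ⟨t₁, ht₁⟩ : ∃ t₁, d + ε / K ≤ g t₁ := by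
        by_contra! hlt
        have h1 : d + ε / K - g t₀ ≤ ∑ t, (d + ε / K - g t) :=
          Finset.single_le_sum (f := fun t => d + ε / K - g t)
            (fun t _ => (sub_pos.2 (hlt t)).le) (Finset.mem_univ t₀)
        rw [Finset.sum_sub_distrib, hsum, Finset.sum_const, Finset.card_univ, nsmul_eq_mul,
          ← hKdef] at h1
        have h2 : K * (d + ε / K) - K * d = ε := by
          field_simp
          ring
        have h3 : 0 < ε / K := by positivity
        have h4 : 0 ≤ (j : ℝ) * (ε / K) := by positivity
        have h5 : g t₀ < δ - ε := ht₀
        linarith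
      refine ⟨fun y => Function.extend (blockEmb hMN l) t₁ (φ y), fun l' hl' t y => ?_, ?_⟩
      · dsimp only
        rw [hφ l' (by omega), extend_comm (blockEmb hMN l).injective (blockEmb hMN l').injective]
        exact blockEmb_ne hMN (Fin.lt_def.2 (Nat.lt_of_succ_le hl'))
      · refine le_trans ?_ ht₁
        push_cast
        linarith
  obtain ⟨φ, -, hφ⟩ := key M le_rfl
  linarith [dens_le_one {y | φ y ∈ D}]

end Blocks

/-! ### Correlation with an intersection of insensitive sets -/

section Correlation

variable {A X Y Z : Type*}

/-- The complement of `⋂ α ∈ J, E α` splits into `|J|` cells of the form `⋂ α, F α`, where each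
`F α` is `E α`, its complement or everything; one of them carries its share of any weight. -/
theorem exists_cell [Fintype Z] (g : Z → ℝ) (E : A → Set Z) (J : Finset A) {c : ℝ}
    (hc : J.card * c < ∑ z, (⋂ α ∈ J, E α)ᶜ.indicator g z) :
    ∃ F : A → Set Z, (∀ α, F α = Set.univ ∨ F α = E α ∨ F α = (E α)ᶜ) ∧
      (∀ α, α ∉ J → F α = Set.univ) ∧ c < ∑ z, (⋂ α, F α).indicator g z := by
  classical
  induction J using Finset.induction_on with
  | empty => simp at hc
  | insert a J ha ih =>
    by_cases hJ : J.card * c < ∑ z, (⋂ α ∈ J, E α)ᶜ.indicator g z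
    · obtain ⟨F, hF, hF', hFc⟩ := ih hJ
      exact ⟨F, hF, fun α hα => hF' α fun h => hα (Finset.mem_insert_of_mem h), hFc⟩
    · refine ⟨fun α => if α = a then (E α)ᶜ else if α ∈ J then E α else Set.univ, fun α => ?_,
        fun α hα => ?_, ?_⟩
      · dsimp only
        split_ifs <;> simp
      · rw [Finset.mem_insert, not_or] at hα
        simp [hα.1, hα.2]
      · have hcell : (⋂ α, if α = a then (E α)ᶜ else if α ∈ J then E α else Set.univ) =
            (⋂ α ∈ J, E α) ∩ (E a)ᶜ := by
          ext z
          simp only [Set.mem_iInter, Set.mem_inter_iff]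
          refine ⟨fun h => ⟨fun α hα => ?_, by simpa using h a⟩, fun h α => ?_⟩
          · have := h α
            rwa [if_neg fun h : α = a => ha (h ▸ hα), if_pos hα] at this
          · split_ifs with h1 h2
            · exact h1 ▸ h.2
            · exact h.1 α h2
            · trivial
        have hsplit : (⋂ α ∈ insert a J, E α)ᶜ = (⋂ α ∈ J, E α)ᶜ ∪ ((⋂ α ∈ J, E α) ∩ (E a)ᶜ) := by
          ext z
          simp only [Finset.set_biInter_insert, Set.mem_compl_iff, Set.mem_inter_iff,
            Set.mem_union]
          tauto
        have hdisj : Disjoint (⋂ α ∈ J, E α)ᶜ ((⋂ α ∈ J, E α) ∩ (E a)ᶜ) :=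
          disjoint_compl_left.mono_right Set.inter_subset_left
        rw [hsplit, Set.indicator_union_of_disjoint hdisj, Finset.sum_add_distrib,
          Finset.card_insert_of_notMem ha] at hc
        push_cast at hc
        rw [hcell]
        linarith

/-- For each `s`, let `E β s` have density at least `d₀`, the intersection of the sets `E α s`,
`α ∈ J`, density at least `d₁`, and its part in `E β s` density at most `d₂`. If `d₂` is small against
`d₀ * d₁`, then `E β` is dense on the complement of that intersection, hence on some cell of it and
in the fibre over some `y`: there its density exceeds `lam`, by an amount that also bounds the size
of the cell from below. -/
theorem exists_increment_cell [Fintype X] [Fintype Y] [Nonempty X] [Nonempty Y]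
    (E : A → X → Set Y) (β : A) (J : Finset A) (hβ : β ∉ J) {c lam d₀ d₁ d₂ : ℝ} (hlam : 0 ≤ lam)
    (h₀ : ∀ s, d₀ ≤ dens (E β s)) (h₁ : ∀ s, d₁ ≤ dens {y | ∀ α ∈ J, y ∈ E α s})
    (h₂ : ∀ s, dens {y | y ∈ E β s ∧ ∀ α ∈ J, y ∈ E α s} ≤ d₂)
    (hc : J.card * c < d₀ - lam - d₂ + lam * d₁) :
    ∃ (y : Y) (F : A → Set X),
      (∀ α, F α = Set.univ ∨ F α = {s | y ∈ E α s} ∨ F α = {s | y ∈ E α s}ᶜ) ∧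
      F β = Set.univ ∧
      c * Fintype.card X <
        (({s | y ∈ E β s} ∩ ⋂ α, F α).ncard : ℝ) - lam * ((⋂ α, F α).ncard : ℝ) := by
  classical
  have hX : (0 : ℝ) < Fintype.card X := Nat.cast_pos.2 Fintype.card_pos
  have hY : (0 : ℝ) < Fintype.card Y := Nat.cast_pos.2 Fintype.card_pos
  let g : X × Y → ℝ := fun z => (E β z.1).indicator 1 z.2 - lam
  let E' : A → Set (X × Y) := fun α => {z | z.2 ∈ E α z.1}
  have hfib : ∀ s, Fintype.card Y * (d₀ - lam - d₂ + lam * d₁) ≤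
      ∑ y, (⋂ α ∈ J, E' α)ᶜ.indicator g (s, y) := by
    intro s
    have hpt : ∀ y, (⋂ α ∈ J, E' α)ᶜ.indicator g (s, y) =
        (E β s).indicator 1 y - lam - {y | y ∈ E β s ∧ ∀ α ∈ J, y ∈ E α s}.indicator 1 y +
          lam * {y | ∀ α ∈ J, y ∈ E α s}.indicator 1 y := by
      intro y
      have hmem : (s, y) ∈ (⋂ α ∈ J, E' α)ᶜ ↔ ¬ ∀ α ∈ J, y ∈ E α s := by
        simp [E']
      by_cases hJ : ∀ α ∈ J, y ∈ E α s
      · rw [Set.indicator_of_notMem fun h => hmem.1 h hJ]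
        have hiff : y ∈ {y | y ∈ E β s ∧ ∀ α ∈ J, y ∈ E α s} ↔ y ∈ E β s := and_iff_left hJ
        rw [Set.indicator_of_mem (show y ∈ {y | ∀ α ∈ J, y ∈ E α s} from hJ)]
        simp only [Set.indicator_apply, hiff, Pi.one_apply]
        ring
      · rw [Set.indicator_of_mem (hmem.2 hJ)]
        simp only [Set.indicator_apply, Set.mem_ofPred_eq, hJ, and_false, if_false, g]
        ring
    simp only [hpt, Finset.sum_add_distrib, Finset.sum_sub_distrib, ← Finset.mul_sum,
      sum_indicator_eq_card_mul_dens, Finset.sum_const, Finset.card_univ, nsmul_eq_mul]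
    have h : d₀ - lam - d₂ + lam * d₁ ≤ dens (E β s) - lam -
        dens {y | y ∈ E β s ∧ ∀ α ∈ J, y ∈ E α s} + lam * dens {y | ∀ α ∈ J, y ∈ E α s} := by
      have := mul_le_mul_of_nonneg_left (h₁ s) hlam
      linarith [h₀ s, h₂ s]
    refine (mul_le_mul_of_nonneg_left h hY.le).trans_eq ?_
    ring
  obtain ⟨F, hF, hFJ, hFc⟩ := exists_cell g E' J
    (c := c * Fintype.card X * Fintype.card Y) (by
      rw [Fintype.sum_prod_type]
      refine lt_of_lt_of_le ?_ (Finset.sum_le_sum fun s _ => hfib s)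
      rw [Finset.sum_const, Finset.card_univ, nsmul_eq_mul]
      have := mul_lt_mul_of_pos_left hc (mul_pos hX hY)
      linarith)
  rw [Fintype.sum_prod_type_right] at hFc
  obtain ⟨y, -, hy⟩ : ∃ y ∈ Finset.univ, c * Fintype.card X <
      ∑ s, (⋂ α, F α).indicator g (s, y) := by
    refine Finset.exists_lt_of_sum_lt (f := fun _ : Y => c * (Fintype.card X : ℝ)) ?_
    rw [Finset.sum_const, Finset.card_univ, nsmul_eq_mul, mul_comm]
    exact hFc
  refine ⟨y, fun α => {s | (s, y) ∈ F α}, fun α => ?_, ?_, hy.trans_eq ?_⟩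
  · rcases hF α with h | h | h
    · exact Or.inl (by simp [h])
    · exact Or.inr (Or.inl (by simp [h, E']))
    · refine Or.inr (Or.inr ?_)
      simp only [h]
      rfl
  · simp [hFJ β hβ]
  · rw [← sum_indicator_one, ← sum_indicator_one, Finset.mul_sum, ← Finset.sum_sub_distrib]
    refine Finset.sum_congr rfl fun s _ => ?_
    by_cases h : ∀ α, (s, y) ∈ F α
    · rw [Set.indicator_of_mem (Set.mem_iInter.2 h)]
      simp [Set.indicator_apply, h, g]
    · rw [Set.indicator_of_notMem fun h' => h (Set.mem_iInter.1 h')]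
      simp [h]

/-- Let letters be added one at a time to a set whose weight is at least `d₀` at first and not
positive in the end. At the first step where the weight is multiplied by at most `c`, the set `J`
reached so far has lost at most the factor `c` in each of the `|J| - 1` earlier steps. -/
theorem exists_drop [Fintype A] [Nonempty A] [DecidableEq A] (w : Finset A → ℝ) {c d₀ : ℝ}
    (hc : 0 < c) (hd₀ : 0 < d₀) (h₀ : ∀ a, d₀ ≤ w {a}) (h₁ : w Finset.univ ≤ 0) :
    ∃ (J : Finset A) (β : A), J.Nonempty ∧ β ∉ J ∧ w (insert β J) ≤ c * w J ∧
      c ^ (J.card - 1) * d₀ ≤ w J := by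
  by_contra! h
  have key : ∀ J : Finset A, J.Nonempty → c ^ (J.card - 1) * d₀ ≤ w J := by
    intro J hJ
    induction hJ using Finset.Nonempty.cons_induction with
    | singleton a => simpa using h₀ a
    | cons a J ha hJ ih =>
      rw [Finset.cons_eq_insert]
      by_contra hlt
      refine absurd (h J a hJ ha ?_) (not_lt.2 ih)
      refine (not_le.1 hlt).le.trans ?_
      rw [Finset.card_insert_of_notMem ha, Nat.add_sub_cancel]
      obtain ⟨j, hj⟩ := Nat.exists_eq_succ_of_ne_zero (Finset.card_pos.2 hJ).ne'
      rw [hj] at ih ⊢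
      rw [Nat.succ_sub_one] at ih
      calc c ^ j.succ * d₀ = c * (c ^ j * d₀) := by rw [pow_succ']; ring
        _ ≤ c * w J := mul_le_mul_of_nonneg_left ih hc.le
  have := key Finset.univ Finset.univ_nonempty
  have hpos : 0 < c ^ ((Finset.univ : Finset A).card - 1) * d₀ := by positivity
  linarith

end Correlation


/-! ### Lines through the points with last letter `β` -/

section Lines

open Combinatorics

variable {A : Type*} {m n N : ℕ}

/-- The variable word that agrees with `w` on the block of coordinates `e` and with the constant
word `z` elsewhere. -/
noncomputable def VarWord.embed (w : VarWord A m N) (e : Fin N ↪o Fin n) (z : Fin n → A) :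
    VarWord A m n where
  idxFun := Function.extend e w.idxFun (Sum.inl ∘ z)
  proper i := by
    obtain ⟨p, hp⟩ := w.proper i
    exact ⟨e p, by rw [e.injective.extend_apply, hp]⟩
  ordered i j hij p q hp hq := by
    have hrange : ∀ {i p}, Function.extend e w.idxFun (Sum.inl ∘ z) p = Sum.inr i →
        ∃ p', e p' = p ∧ w.idxFun p' = Sum.inr i := by
      intro i p hp
      by_cases h : ∃ p', e p' = p
      · obtain ⟨p', rfl⟩ := h
        exact ⟨p', rfl, by rwa [e.injective.extend_apply] at hp⟩
      · rw [Function.extend_apply' _ _ _ h] at hp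
        cases hp
    obtain ⟨p', rfl, hp'⟩ := hrange hp
    obtain ⟨q', rfl, hq'⟩ := hrange hq
    exact e.lt_iff_lt.2 (w.ordered i j hij p' q' hp' hq')

theorem VarWord.embed_subst (w : VarWord A m N) (e : Fin N ↪o Fin n) (z : Fin n → A)
    (s : Fin m → A) : (w.embed e z).subst s = Function.extend e (w.subst s) z := by
  funext i
  change (Function.extend e w.idxFun (Sum.inl ∘ z) i).elim id s = _
  by_cases h : ∃ p, e p = i
  · obtain ⟨p, rfl⟩ := h
    rw [e.injective.extend_apply, e.injective.extend_apply, VarWord.subst_apply]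
  · rw [Function.extend_apply' _ _ _ h, Function.extend_apply' _ _ _ h]
    rfl

open Classical in
/-- The line of `A ^ (m + 1)` obtained from the word `s` by replacing the letter `β` with the
variable, and appending the variable. Its point at `β` is `s` followed by `β`. -/
noncomputable def lineThrough (β : A) (s : Fin m → A) : Line A (Fin (m + 1)) where
  idxFun p := if h : p.1 < m then (if s ⟨p, h⟩ = β then none else some (s ⟨p, h⟩)) else none
  proper := ⟨Fin.last m, by simp⟩

theorem lineThrough_self (β : A) (s : Fin m → A) :
    lineThrough β s β = (VarWord.initial β m.le_succ).subst s := by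
  funext p
  rw [VarWord.subst_apply, Line.coe_apply]
  by_cases h : p.1 < m
  · by_cases h' : s ⟨p, h⟩ = β <;> simp [lineThrough, VarWord.initial, h, h']
  · simp [lineThrough, VarWord.initial, h]

/-- The point of `lineThrough β s` at `α` does not change when letters `α` and `β` are exchanged in
`s`. This makes the sets of words defined through that point insensitive. -/
theorem lineThrough_eq_of_equivalent {α β : A} {s t : Fin m → A} (h : Equivalent α β s t) :
    lineThrough β s α = lineThrough β t α := by
  classical
  funext p
  simp only [Line.coe_apply, lineThrough]
  by_cases hp : p.1 < m
  · simp only [hp, dif_pos]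
    have hs := h ⟨p, hp⟩ (s ⟨p, hp⟩)
    have ht := h ⟨p, hp⟩ (t ⟨p, hp⟩)
    have hget : ∀ a, (if a = β then none else some a).getD α = if a = β then α else a :=
      fun a => by split_ifs <;> rfl
    rw [hget, hget]
    grind
  · simp [hp]

end Lines

/-! ### Quantized densities -/

section Quantization

/-- The level of `x ∈ [0, 1]` when `(0, 1]` is cut into `r` half-open intervals of equal length;
`0` belongs to the first level. -/
noncomputable def level (r : ℕ) (hr : 0 < r) (x : ℝ) (hx : x ≤ 1) : Fin r :=
  ⟨⌈x * r⌉₊ - 1, by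
    have : ⌈x * r⌉₊ ≤ r := Nat.ceil_le.2 (by nlinarith [(Nat.cast_nonneg r : (0 : ℝ) ≤ r)])
    omega⟩

theorem le_add_inv_of_level_eq {r : ℕ} {hr : 0 < r} {x y : ℝ} {hx : x ≤ 1} {hy : y ≤ 1}
    (hy0 : 0 ≤ y) (h : level r hr x hx = level r hr y hy) : x ≤ y + (r : ℝ)⁻¹ := by
  have hr' : (0 : ℝ) < r := Nat.cast_pos.2 hr
  have hval : ⌈x * r⌉₊ - 1 = ⌈y * r⌉₊ - 1 := congrArg Fin.val h
  have h1 : x * r ≤ ⌈x * r⌉₊ := Nat.le_ceil _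
  have h2 : (⌈y * r⌉₊ : ℝ) < y * r + 1 := Nat.ceil_lt_add_one (by positivity)
  have h3 : x * r ≤ y * r + 1 := by
    by_cases hy' : ⌈y * r⌉₊ = 0
    · have : (⌈x * r⌉₊ : ℝ) ≤ 1 := by
        have : ⌈x * r⌉₊ ≤ 1 := by omega
        exact_mod_cast this
      have : 0 ≤ y * r := by positivity
      linarith
    · have : (⌈x * r⌉₊ : ℝ) ≤ ⌈y * r⌉₊ := by
        have : ⌈x * r⌉₊ ≤ ⌈y * r⌉₊ := by omega
        exact_mod_cast this
      linarith
  have h4 : (y + (r : ℝ)⁻¹) * r = y * r + 1 := by field_simp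
  exact le_of_mul_le_mul_right (h3.trans_eq h4.symm) hr'

end Quantization

/-! ### The density increment -/

section Increment

open Combinatorics

/-- The hypothesis of `exists_increment_cell` for `|J| = k`, threshold `lam = δ + ε / 2` and densities
`d₀ = δ - ε`, `d₁ = x - ε`, `d₂ = δ / 4 * x + ε`. The main term `3 / 4 * δ * x` on the right is at least
`3 / 2 * θ` with `θ = δ ^ (k + 1) / 4 ^ k`, the errors are at most `4 * ε ≤ 2 / 3 * θ`, and the left
side is at most `θ / 16`. -/
theorem increment_inequality {k : ℕ} (hk : 2 ≤ k) {δ ε x : ℝ} (hδ0 : 0 < δ) (hδ1 : δ ≤ 1)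
    (hε : ε = δ ^ (k + 1) / (2 * ((k : ℝ) + 1) * 4 ^ k))
    (hx : (δ / 4) ^ (k - 1) * (δ - ε) ≤ x) :
    k * (δ ^ (2 * k + 1) / (((k : ℝ) + 1) ^ 2 * 4 ^ (k + 2))) <
      (δ - ε) - (δ + ε / 2) - (δ / 4 * x + ε) + (δ + ε / 2) * (x - ε) := by
  have hk' : (2 : ℝ) ≤ k := by exact_mod_cast hk
  set θ : ℝ := δ ^ (k + 1) / 4 ^ k with hθ
  have hθ0 : 0 < θ := by positivity
  have hεθ : ε * (2 * ((k : ℝ) + 1)) = θ := by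
    rw [hε, hθ]
    field_simp
  have hε0 : 0 < ε := by rw [hε]; positivity
  have hε6 : 6 * ε ≤ θ := by nlinarith
  have hθδ : 16 * θ ≤ δ := by
    have h1 : δ ^ (k + 1) ≤ δ := pow_le_of_le_one hδ0.le hδ1 (by omega)
    have h2 : (4 : ℝ) ^ 2 ≤ 4 ^ k := pow_le_pow_right₀ (by norm_num) hk
    rw [hθ, mul_div_assoc', div_le_iff₀ (by positivity)]
    nlinarith
  have hpow : δ * ((δ / 4) ^ (k - 1) * δ) = 4 * θ := by
    obtain ⟨j, rfl⟩ : ∃ j, k = j + 1 := ⟨k - 1, by omega⟩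
    rw [hθ, Nat.add_sub_cancel, div_pow]
    field_simp
    ring
  have hx2 : 2 * θ ≤ δ * x := by
    have h0 : 0 ≤ (δ / 4) ^ (k - 1) := by positivity
    have h1 : (δ / 4) ^ (k - 1) * (δ / 2) ≤ (δ / 4) ^ (k - 1) * (δ - ε) :=
      mul_le_mul_of_nonneg_left (by linarith) h0
    have h2 := mul_le_mul_of_nonneg_left (h1.trans hx) hδ0.le
    linarith
  have hx0 : 0 < x := by
    by_contra h
    nlinarith
  have hleft : k * (δ ^ (2 * k + 1) / (((k : ℝ) + 1) ^ 2 * 4 ^ (k + 2))) ≤ θ / 16 := by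
    have h1 : k * (δ ^ (2 * k + 1) / (((k : ℝ) + 1) ^ 2 * 4 ^ (k + 2))) =
        θ / 16 * (δ ^ k * (k / ((k : ℝ) + 1) ^ 2)) := by
      rw [hθ]
      field_simp
      ring
    have h2 : δ ^ k ≤ 1 := pow_le_one₀ hδ0.le hδ1
    have h3 : (k : ℝ) / ((k : ℝ) + 1) ^ 2 ≤ 1 := by
      rw [div_le_one (by positivity)]
      nlinarith
    rw [h1]
    refine mul_le_of_le_one_right (by positivity) (mul_le_one₀ h2 (by positivity) h3)
  have hε1 : ε * δ ≤ ε := mul_le_of_le_one_right hε0.le hδ1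
  have hε2 : ε * ε ≤ ε := mul_le_of_le_one_right hε0.le (by linarith)
  have hεx : 0 < ε * x := mul_pos hε0 hx0
  linarith

theorem card_finset_nonempty (A : Type*) [Fintype A] :
    Fintype.card {J : Finset A // J.Nonempty} = 2 ^ Fintype.card A - 1 := by
  classical
  rw [Fintype.card_congr (Equiv.subtypeEquivRight fun _ => Finset.nonempty_iff_ne_empty),
    Fintype.card_subtype_compl, Fintype.card_subtype_eq, Fintype.card_finset]

/-- A Graham–Rothschild argument for finitely many functions on lines: they can all be made constant
up to `1 / r` on the lines of some `m`-dimensional combinatorial space. -/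
theorem LineRamsey.exists_almost_constant {A : Type*} [Fintype A] {ι : Type*} [Fintype ι]
    {m N r : ℕ} (hr : 0 < r) (h : LineRamsey A m N (r ^ Fintype.card ι))
    (f : ι → Line A (Fin N) → ℝ) (hf0 : ∀ i ℓ, 0 ≤ f i ℓ) (hf1 : ∀ i ℓ, f i ℓ ≤ 1) :
    ∃ w : VarWord A m N, ∀ i ℓ ℓ', f i (w.compLine ℓ) ≤ f i (w.compLine ℓ') + (r : ℝ)⁻¹ := by
  classical
  let e : (ι → Fin r) ≃ Fin (r ^ Fintype.card ι) := Fintype.equivFinOfCardEq (by simp)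
  obtain ⟨w, c, hw⟩ := h fun ℓ => e fun i => level r hr (f i ℓ) (hf1 i ℓ)
  refine ⟨w, fun i ℓ ℓ' => ?_⟩
  have := e.injective ((hw ℓ).trans (hw ℓ').symm)
  exact le_add_inv_of_level_eq (hf0 _ _) (congrFun this i)

end Increment

end DensityHJ

open DensityHJ Combinatorics in
theorem mainTheorem4 (m k : ℕ) (hk : 2 ≤ k) (hm : k ≤ m)
    (δ : ℝ) (hδ0 : 0 < δ) (hδ1 : δ ≤ 1)
    (N : ℕ)
    (hN : N = DensityHJ.GRL (k + 1) (m + 1)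
      (⌈2 * ((k : ℝ) + 1) * 4 ^ k * (δ ^ (k + 1))⁻¹⌉₊ ^ (2 ^ (k + 1) - 1)))
    (n : ℕ) (hn0 : 0 < n)
    (hn : 2 * ((k : ℝ) + 1) * 4 ^ k / δ ^ (k + 1) * ((k : ℝ) + 1) ^ N * (N : ℝ) ≤ (n : ℝ))
    (A : Type*) [Fintype A] (hA : Fintype.card A = k + 1)
    (D : Set (Fin n → A))
    (hD : δ * (Nat.card (Fin n → A) : ℝ) ≤ (D.ncard : ℝ)) :
    (∃ L : Set (Fin n → A), DensityHJ.IsCombLine L ∧ L ⊆ D) ∨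
    (∃ (β : A) (v : DensityHJ.VarWord A m n) (S : Set (Fin n → A)) (E : A → Set (Fin n → A)),
      S ⊆ v.space ∧
      S = ⋂ α ∈ {α : A | α ≠ β}, E α ∧
      (∀ α : A, α ≠ β → v.InsensitiveIn α β (E α)) ∧
      δ ^ (2 * k + 1) / (((k : ℝ) + 1) ^ 2 * 4 ^ (k + 2))
        ≤ (S.ncard : ℝ) / (v.space.ncard : ℝ) ∧
      δ + δ ^ (k + 1) / (((k : ℝ) + 1) * 4 ^ (k + 1))
        ≤ ((D ∩ S).ncard : ℝ) / (S.ncard : ℝ)) := by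
  classical
  refine or_iff_not_imp_left.2 fun hline => ?_
  have : Nontrivial A := Fintype.one_lt_card_iff_nontrivial.1 (by omega)
  set ε : ℝ := δ ^ (k + 1) / (2 * ((k : ℝ) + 1) * 4 ^ k) with hε
  have hε0 : 0 < ε := by positivity
  have hεδ : ε ≤ δ / 2 := by
    have h1 : δ ^ (k + 1) ≤ δ := pow_le_of_le_one hδ0.le hδ1 (by omega)
    have h2 : (1 : ℝ) ≤ 4 ^ k := one_le_pow₀ (by norm_num)
    have h3 : (2 : ℝ) ≤ 2 * ((k : ℝ) + 1) * 4 ^ k := by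
      nlinarith [(Nat.cast_nonneg k : (0 : ℝ) ≤ k)]
    exact div_le_div₀ hδ0.le h1 (by norm_num) h3
  have hinv : 2 * ((k : ℝ) + 1) * 4 ^ k * (δ ^ (k + 1))⁻¹ = ε⁻¹ := by
    rw [hε, inv_div, div_eq_mul_inv]
  -- Densities are rounded to `r` levels, so that equal levels mean a difference of at most `ε`.
  set r : ℕ := ⌈2 * ((k : ℝ) + 1) * 4 ^ k * (δ ^ (k + 1))⁻¹⌉₊ with hrdef
  have hr : 0 < r := Nat.ceil_pos.2 (by positivity)
  have hrε : (r : ℝ)⁻¹ ≤ ε := by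
    refine inv_le_of_inv_le₀ hε0 ?_
    rw [← hinv]
    exact Nat.le_ceil _
  obtain ⟨hN0, hGRL⟩ := GRL_spec (k := k + 1) (by omega) (m + 1) (r ^ (2 ^ (k + 1) - 1))
  rw [← hN] at hN0 hGRL
  have hRamsey : LineRamsey A (m + 1) N (r ^ Fintype.card {J : Finset A // J.Nonempty}) := by
    rw [card_finset_nonempty, hA]
    exact (hGRL.lineRamsey (by omega)).of_equiv (Fintype.equivFinOfCardEq hA)
  -- Some block of `N` coordinates has all its sections of density at least `δ - ε`.
  obtain ⟨e, φ, hφ⟩ := exists_block (N := N) (M := n / N) (δ := δ) D (Nat.div_mul_le_self n N) hε0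
    (by
      rw [dens, le_div_iff₀ (Nat.cast_pos.2 Fintype.card_pos), ← Nat.card_eq_fintype_card]
      exact hD)
    (by
      have hcard : (Fintype.card (Fin N → A) : ℝ) = ((k : ℝ) + 1) ^ N := by
        rw [Fintype.card_fun, Fintype.card_fin, hA]
        push_cast
        rfl
      rw [hcard]
      have hK : (1 : ℝ) ≤ ((k : ℝ) + 1) ^ N :=
        one_le_pow₀ (by linarith [(Nat.cast_nonneg k : (0 : ℝ) ≤ k)])
      have hN' : (0 : ℝ) < N := Nat.cast_pos.2 hN0
      have h1 : (n : ℝ) < ((n / N : ℕ) + 1) * N := by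
        exact_mod_cast Nat.lt_mul_of_div_lt (Nat.lt_succ_self _) hN0
      have h2 : ε⁻¹ * ((k : ℝ) + 1) ^ N < (n / N : ℕ) + 1 := by
        refine lt_of_mul_lt_mul_right ?_ hN'.le
        refine lt_of_le_of_lt (le_of_eq_of_le ?_ hn) h1
        rw [← hinv, div_eq_mul_inv]
      set K : ℝ := ((k : ℝ) + 1) ^ N
      have hK0 : 0 < K := by linarith
      have h3 : 1 < ((n / N : ℕ) + 1) * (ε / K) := by
        have := mul_lt_mul_of_pos_right h2 (show 0 < ε / K by positivity)
        refine lt_of_eq_of_lt ?_ this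
        field_simp
      have h4 : ε / K ≤ ε := div_le_self hε0.le hK
      linarith)
  -- Lines are colored by the quantized densities of the intersections of sections along them.
  obtain ⟨w, hw⟩ := hRamsey.exists_almost_constant hr
    (fun J ℓ => dens {y | ∀ α ∈ J.1, Function.extend e (ℓ α) (φ y) ∈ D})
    (fun _ _ => dens_nonneg _) (fun _ _ => dens_le_one _)
  let E : A → Line A (Fin (m + 1)) → Set (Fin n → A) := fun α ℓ =>
    {y | Function.extend e (w.compLine ℓ α) (φ y) ∈ D}
  let ℓ₀ : Line A (Fin (m + 1)) := Line.diagonal A (Fin (m + 1))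
  have hclose : ∀ J : Finset A, J.Nonempty → ∀ ℓ ℓ', dens {y | ∀ α ∈ J, y ∈ E α ℓ} ≤
      dens {y | ∀ α ∈ J, y ∈ E α ℓ'} + ε := fun J hJ ℓ ℓ' =>
    (hw ⟨J, hJ⟩ ℓ ℓ').trans (add_le_add le_rfl hrε)
  have hE : ∀ α ℓ, δ - ε ≤ dens (E α ℓ) := fun α ℓ => hφ (w.compLine ℓ α)
  -- The weight of `univ` vanishes because a common point of all sections gives a line inside `D`.
  obtain ⟨J, β, hJ, hβ, hdrop, hJlarge⟩ := exists_drop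
    (fun J : Finset A => dens {y | ∀ α ∈ J, y ∈ E α ℓ₀}) (c := δ / 4) (d₀ := δ - ε)
    (by positivity) (by linarith)
    (fun a => by simpa using hE a ℓ₀)
    (by
      have hempty : {y | ∀ α ∈ (Finset.univ : Finset A), y ∈ E α ℓ₀} = ∅ := by
        refine Set.eq_empty_of_forall_notMem fun y hy => hline ?_
        refine ⟨_, ⟨(w.embed e (φ y)).compLine ℓ₀, rfl⟩, ?_⟩
        rintro _ ⟨a, rfl⟩
        have h := hy a (Finset.mem_univ a)
        simp only [E, Set.mem_ofPred_eq, VarWord.compLine_apply] at h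
        simpa only [VarWord.compLine_apply, VarWord.embed_subst] using h
      simp only [hempty, dens, Set.ncard_empty, Nat.cast_zero, zero_div, le_refl])
  have hJcard : J.card ≤ k := by
    have := Finset.card_lt_univ_of_notMem hβ
    omega
  set x : ℝ := dens {y | ∀ α ∈ J, y ∈ E α ℓ₀} with hx
  have hineq := increment_inequality hk hδ0 hδ1 hε (x := x) (by
    refine le_trans (mul_le_mul_of_nonneg_right ?_ (by linarith)) hJlarge
    exact pow_le_pow_of_le_one (by positivity) (by linarith) (by omega))
  set c : ℝ := δ ^ (2 * k + 1) / (((k : ℝ) + 1) ^ 2 * 4 ^ (k + 2)) with hc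
  have hc0 : 0 < c := by positivity
  obtain ⟨y, F, hF, hFβ, hcell⟩ := exists_increment_cell
    (fun α (s : Fin m → A) => E α (lineThrough β s)) β J hβ (c := c) (lam := δ + ε / 2)
    (d₀ := δ - ε) (d₁ := x - ε) (d₂ := δ / 4 * x + ε) (by positivity) (fun s => hE β _)
    (fun s => by linarith [hclose J hJ ℓ₀ (lineThrough β s)])
    (fun s => by
      have h := hclose (insert β J) (Finset.insert_nonempty β J) (lineThrough β s) ℓ₀
      simp only [Finset.forall_mem_insert] at h hdrop
      linarith)
    (lt_of_le_of_lt (mul_le_mul_of_nonneg_right (Nat.cast_le.2 hJcard) hc0.le) hineq)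
  -- The space of the points `w(s, β)`, placed in the chosen block and completed by `φ y`.
  let v : VarWord A m n := (w.comp (VarWord.initial β m.le_succ)).embed e (φ y)
  have hv : ∀ s, v.subst s ∈ D ↔ y ∈ E β (lineThrough β s) := fun s => by
    simp only [v, E, VarWord.embed_subst, VarWord.comp_subst, VarWord.compLine_apply,
      lineThrough_self, Set.mem_ofPred_eq]
  -- Dropping `F β` loses nothing as it is everything; a letter `γ ≠ β` keeps the intersection in `V`.
  obtain ⟨γ, hγ⟩ := exists_ne β
  have hS : v.subst '' (⋂ α, F α) = ⋂ α ∈ {α : A | α ≠ β}, v.subst '' F α := by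
    ext z
    simp only [Set.mem_iInter, Set.mem_ofPred_eq]
    constructor
    · rintro ⟨s, hs, rfl⟩ α -
      exact ⟨s, Set.mem_iInter.1 hs α, rfl⟩
    · intro h
      obtain ⟨s, -, rfl⟩ := h γ hγ
      refine ⟨s, Set.mem_iInter.2 fun α => ?_, rfl⟩
      by_cases hα : α = β
      · rw [hα, hFβ]
        trivial
      · obtain ⟨t, ht, hts⟩ := h α hα
        rwa [← v.subst_injective hts]
  have hScard : (v.subst '' (⋂ α, F α)).ncard = (⋂ α, F α).ncard :=
    Set.ncard_image_of_injective _ v.subst_injective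
  have hDS : (D ∩ v.subst '' (⋂ α, F α)).ncard =
      ({s | y ∈ E β (lineThrough β s)} ∩ ⋂ α, F α).ncard := by
    rw [← Set.ncard_image_of_injective _ v.subst_injective]
    congr 1
    ext z
    constructor
    · rintro ⟨hz, s, hs, rfl⟩
      exact ⟨s, ⟨(hv s).1 hz, hs⟩, rfl⟩
    · rintro ⟨s, ⟨hs, hs'⟩, rfl⟩
      exact ⟨(hv s).2 hs, s, hs', rfl⟩
  have hVcard : v.space.ncard = Fintype.card (Fin m → A) := by
    rw [VarWord.space, ← Set.image_univ, Set.ncard_image_of_injective _ v.subst_injective,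
      Set.ncard_univ, Nat.card_eq_fintype_card]
  have hX : (0 : ℝ) < Fintype.card (Fin m → A) := Nat.cast_pos.2 Fintype.card_pos
  have hle : (({s | y ∈ E β (lineThrough β s)} ∩ ⋂ α, F α).ncard : ℝ) ≤ (⋂ α, F α).ncard :=
    Nat.cast_le.2 (Set.ncard_le_ncard Set.inter_subset_right)
  have hSlarge : c * Fintype.card (Fin m → A) < ((⋂ α, F α).ncard : ℝ) := by
    have : 0 ≤ (δ + ε / 2) * ((⋂ α, F α).ncard : ℝ) := by positivity
    linarith
  refine ⟨β, v, v.subst '' (⋂ α, F α), fun α => v.subst '' F α, Set.image_subset_range _ _, hS,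
    fun α hα => ⟨Set.image_subset_range _ _, ?_⟩, ?_, ?_⟩
  · rw [Set.preimage_image_eq _ v.subst_injective]
    intro s t hst
    have h := lineThrough_eq_of_equivalent hst
    have hmem : y ∈ E α (lineThrough β t) ↔ y ∈ E α (lineThrough β s) := by
      simp only [E, Set.mem_ofPred_eq, VarWord.compLine_apply, h]
    rcases hF α with h' | h' | h' <;> rw [h']
    · exact Iff.rfl
    · exact hmem
    · exact not_congr hmem
  · rw [hScard, hVcard, le_div_iff₀ hX]
    exact hSlarge.le
  · have hpos : (0 : ℝ) < (⋂ α, F α).ncard := lt_trans (by positivity) hSlarge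
    have hinc : δ ^ (k + 1) / (((k : ℝ) + 1) * 4 ^ (k + 1)) = ε / 2 := by
      rw [hε]
      field_simp
      ring
    rw [hDS, hScard, le_div_iff₀ hpos, hinc]
    have : 0 < c * Fintype.card (Fin m → A) := by positivity
    linarith
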